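/- Let $n\ge 0$ and let $\mathbb A_n=\{e_i-e_j : 1\le i\ne j\le n+1\}\subset\mathbb R^{n+1}$ be the root system of type $A_n$, of rank $n$, with base $S=\{e_i-e_{i+1} : 1\le i\le n\}$ and positive roots $\mathbb A_n^+=\{e_i-e_j : i<j\}$. More generally, write $R^+$ for the positive roots of a root system $R$ with base $S$. A subset $\Phi\subseteq R^+$ is closed if $\alpha+\beta\in\Phi$ whenever $\alpha,\beta\in\Phi$ and $\alpha+\beta\in R^+$. It is an inversion set if both $\Phi$ and $R^+\setminus\Phi$ are closed. A fine decomposition of $R$ is an unordered decomposition $R^+=\Phi_1\sqcup\dots\sqcup\Phi_r$ into non-empty pairwise disjoint inversion sets, where $r$ is the rank of $R$. For $I\subseteq S$ let $\pi_I$ be the projection modulo $\operatorname{span} I$. A subset $\Phi\subseteq R^+$ is an inflation from $I$ if $\Phi=\{\alpha\in R^+ : \pi_I(\alpha)\in\Psi\}\cup X$ for some $\Psi\subseteq \pi_I(R^+)\setminus\{0\}$ and some $X\subseteq R^+\cap\operatorname{span} I$. A subset $\Phi\subseteq R^+$ is primitive if $\Phi\ne\emptyset$, $\Phi\neq R^+$,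 and $\Phi$ is an inflation from $I$ only for $I=\emptyset$ and $I=S$. Let $a_n$ be the number of fine decompositions of $\mathbb A_n$. Then: 1. $\mathbb A_2^+$ has no primitive inversion sets. 2. $a_0=1$, and $a_n=\sum_{i=1}^{n}a_{i-1}a_{n-i}$ for all $n\ge 1$. 3. For all $n\ge 0$, $a_n=\frac{1}{n+1}\binom{2n}{n}$, the $n$-th Catalan number. -/

import Mathlib

namespace FineDecomposition

section General

variable {V : Type*} [AddCommGroup V] [Module ℝ V]

/-- The positive roots of `R` with respect to the base `S`: the roots that are combinations of `S`
with non-negative integer coefficients. -/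
def positiveRoots (R S : Set V) : Set V :=
  {α | α ∈ R ∧ α ∈ AddSubmonoid.closure S}

/-- `Φ` is closed in the set `P` of positive roots: a sum of two elements of `Φ` which is again a
root (it is then a positive root) lies in `Φ`. -/
def IsClosedIn (P Φ : Set V) : Prop :=
  ∀ α ∈ Φ, ∀ β ∈ Φ, α + β ∈ P → α + β ∈ Φ

/-- `Φ` is co-closed in `P`: its complement in `P` is closed. -/
def IsCoclosedIn (P Φ : Set V) : Prop :=
  IsClosedIn P (P \ Φ)

/-- Inversion sets in the set `P` of positive roots. -/
structure IsInversionSet (P Φ : Set V) : Prop where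
  subset : Φ ⊆ P
  closed : IsClosedIn P Φ
  coclosed : IsCoclosedIn P Φ

/-- `D` is an (unordered) decomposition of `Φ` into non-empty pairwise disjoint inversion sets. -/
structure IsDecomposition (P Φ : Set V) (D : Set (Set V)) : Prop where
  inversion : ∀ A ∈ D, IsInversionSet P A
  nonempty : ∀ A ∈ D, A.Nonempty
  disjoint : ∀ A ∈ D, ∀ B ∈ D, A ≠ B → Disjoint A B
  union : ⋃₀ D = Φ

/-- The rank: the dimension of the real vector space spanned by the (positive) roots. -/
noncomputable def rank (P : Set V) : ℕ :=
  Module.finrank ℝ (Submodule.span ℝ P)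

/-- A fine decomposition of the set `P` of all positive roots: the number of parts is the rank. -/
def IsFineDecomposition (P : Set V) (D : Set (Set V)) : Prop :=
  IsDecomposition P P D ∧ D.encard = (rank P : ℕ∞)

/-- The number of fine decompositions. -/
noncomputable def fineCount (P : Set V) : ℕ :=
  {D : Set (Set V) | IsFineDecomposition P D}.ncard

/-- The positive roots of the quotient by `I`: the non-zero images of the positive roots under the
projection `V → V / span I`. -/
def quotientPositiveRoots (P I : Set V) : Set (V ⧸ Submodule.span ℝ I) :=
  ((Submodule.span ℝ I).mkQ '' P) \ {0}

/-- The positive roots of the subsystem of roots lying in `span I`. -/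
def subsystemPositiveRoots (P I : Set V) : Set V :=
  P ∩ (Submodule.span ℝ I : Set V)

/-- `Φ` is the inflation from `I` of `Ψ` by `X`. The preimage of `Ψ` is taken among the positive
roots. -/
structure IsInflation (P I Φ : Set V) (Ψ : Set (V ⧸ Submodule.span ℝ I)) (X : Set V) : Prop where
  quotient_subset : Ψ ⊆ quotientPositiveRoots P I
  sub_subset : X ⊆ subsystemPositiveRoots P I
  eq : Φ = {α | α ∈ P ∧ (Submodule.span ℝ I).mkQ α ∈ Ψ} ∪ X

/-- `Φ` is primitive (with `P` the positive roots with respect to the base `S`): it is neither empty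
nor everything, and it is an inflation only from `∅` and from `S`. -/
structure IsPrimitive (P S Φ : Set V) : Prop where
  subset : Φ ⊆ P
  ne_empty : Φ ≠ ∅
  ne_all : Φ ≠ P
  inflation : ∀ I ⊆ S, ∀ (Ψ : Set (V ⧸ Submodule.span ℝ I)) (X : Set V),
    IsInflation P I Φ Ψ X → I = ∅ ∨ I = S

end General

/-- The root system of type `A_n`: the vectors `e_i - e_j`, `i ≠ j`, in `ℝ^{n+1}`. Its ambient space
is their span, the hyperplane of vectors with coordinate sum zero. -/
def rootsA (n : ℕ) : Set (EuclideanSpace ℝ (Fin (n + 1))) :=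
  {α | ∃ i j : Fin (n + 1), i ≠ j ∧
    α = EuclideanSpace.single i (1 : ℝ) - EuclideanSpace.single j (1 : ℝ)}

/-- The standard base of `A_n`: the simple roots `e_i - e_{i+1}`. -/
def baseA (n : ℕ) : Set (EuclideanSpace ℝ (Fin (n + 1))) :=
  {α | ∃ i : Fin n,
    α = EuclideanSpace.single i.castSucc (1 : ℝ) - EuclideanSpace.single i.succ (1 : ℝ)}

/-- The positive roots of `A_n` with respect to the standard base. -/
def positiveRootsA (n : ℕ) : Set (EuclideanSpace ℝ (Fin (n + 1))) :=
  positiveRoots (rootsA n) (baseA n)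

/-- The number of fine decompositions of `A_n`. -/
noncomputable def a (n : ℕ) : ℕ :=
  fineCount (positiveRootsA n)

end FineDecomposition

/-! Co-closedness says that an inversion set containing `e_i - e_k` contains `e_i - e_j` or `e_j -
e_k` whenever `i < j < k`. Hence every non-empty inversion set contains a simple root. A fine
decomposition has `n` disjoint parts and there are `n` simple roots, so each part contains exactly
one, which labels it. Fine decompositions thereby become interval colorings
(`exists_colorDecomposition_eq`, `isFineDecomposition_colorDecomposition`).

The color `m` of the full interval is forced on every pair with `i ≤ m < j` (`eq_of_mem`). All other
pairs lie in `[l, m]` or in `[m + 1, u]`, where the coloring is again an interval coloring.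
Recursively, this is a binary tree with `n` nodes, so the count is the Catalan number
(`a_eq_catalan`), and the recurrence and closed form are those of `catalan`. The claim on `A_2` is a
separate case check on the simple roots. -/

namespace FineDecomposition

/-! ### Interval colorings and binary trees -/

/-- A coloring of the pairs `i < j` of points in `[l, u]` in which `(i, i + 1)` has color `i` and
`(i, k)` has the color of `(i, j)` or of `(j, k)` whenever `i < j < k`. -/
structure IsIntervalColoring (l u : ℕ) (f : ℕ → ℕ → ℕ) : Prop where
  simple : ∀ i, l ≤ i → i < u → f i (i + 1) = i
  split : ∀ i j k, l ≤ i → i < j → j < k → k ≤ u → f i k = f i j ∨ f i k = f j k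

namespace IsIntervalColoring

variable {l u : ℕ} {f : ℕ → ℕ → ℕ}

lemma mono (hf : IsIntervalColoring l u f) {l' u' : ℕ} (hl : l ≤ l') (hu : u' ≤ u) :
    IsIntervalColoring l' u' f :=
  ⟨fun i h1 h2 => hf.simple i (by omega) (by omega),
    fun i j k h1 h2 h3 h4 => hf.split i j k (by omega) h2 h3 (by omega)⟩

lemma mem_Ico (hf : IsIntervalColoring l u f) {i j : ℕ} (hi : l ≤ i) (hij : i < j) (hj : j ≤ u) :
    i ≤ f i j ∧ f i j < j := by
  induction j, hij using Nat.le_induction with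
  | base => rw [hf.simple i hi (by omega)]; omega
  | succ j hij ih =>
    have h1 := ih (by omega)
    have h2 := hf.simple j (by omega) (by omega)
    rcases hf.split i j (j + 1) hi (by omega) (by omega) hj with h | h <;> omega

/-- Trim the interval from the right, then from the left: by `mem_Ico` the piece cut off has its
color inside itself, so it misses `f l u`, and `split` passes this color to the piece kept. -/
lemma eq_of_mem (hf : IsIntervalColoring l u f) {i j : ℕ} (hi : l ≤ i) (him : i ≤ f l u)
    (hmj : f l u < j) (hj : j ≤ u) : f i j = f l u := by
  have h1 : f l j = f l u := by
    rcases hj.eq_or_lt with rfl | hj'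
    · rfl
    · have := hf.mem_Ico (i := j) (j := u) (by omega) hj' le_rfl
      rcases hf.split l j u le_rfl (by omega) hj' le_rfl with h | h <;> omega
  rcases hi.eq_or_lt with rfl | hi'
  · exact h1
  · have := hf.mem_Ico (i := l) (j := i) le_rfl hi' (by omega)
    rcases hf.split l i j le_rfl hi' (by omega) hj with h | h <;> omega

end IsIntervalColoring

/-- The coloring given by a binary search tree on the points from `l` on: the color of `(i, j)` is
the node of the tree nearest to the root that lies in `[i, j)`. -/
def treeColoring : BinaryTree Unit → ℕ → ℕ → ℕ → ℕ
  -- An empty tree spans a single point, which has no pairs; the value is arbitrary.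
  | .nil, _, _, _ => 0
  | .node _ L R, l, i, j =>
    if j ≤ l + L.numNodes then treeColoring L l i j
    else if l + L.numNodes < i then treeColoring R (l + L.numNodes + 1) i j
    else l + L.numNodes

lemma isIntervalColoring_treeColoring (T : BinaryTree Unit) (l : ℕ) :
    IsIntervalColoring l (l + T.numNodes) (treeColoring T l) := by
  induction T generalizing l with
  | nil => exact ⟨fun i h1 h2 => by simp at h2; omega,
      fun i j k h1 h2 h3 h4 => by simp at h4; omega⟩
  | node _ L R hL hR =>
    have hL := hL l
    have hR := hR (l + L.numNodes + 1)
    simp only [BinaryTree.numNodes]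
    refine ⟨fun i h1 h2 => ?_, fun i j k h1 h2 h3 h4 => ?_⟩
    · simp only [treeColoring]
      split_ifs with h h'
      · exact hL.simple i h1 (by omega)
      · exact hR.simple i (by omega) (by omega)
      · omega
    · have hL := hL.split i j k h1 h2 h3
      have hR := fun h => hR.split i j k h h2 h3 (by omega)
      simp only [treeColoring]
      split_ifs <;> omega

lemma exists_treeColoring_eq (n l : ℕ) (f : ℕ → ℕ → ℕ) (hf : IsIntervalColoring l (l + n) f) :
    ∃ T : BinaryTree Unit, T.numNodes = n ∧
      ∀ i j, l ≤ i → i < j → j ≤ l + n → f i j = treeColoring T l i j := by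
  induction n using Nat.strong_induction_on generalizing l with
  | _ n ih =>
    rcases Nat.eq_zero_or_pos n with rfl | hn
    · exact ⟨.nil, rfl, fun i j h1 h2 h3 => by omega⟩
    · have hm := hf.mem_Ico (i := l) (j := l + n) le_rfl (by omega) le_rfl
      -- The root is the color `l + p` of the full interval, leaving `p` nodes to its left and `n -
      -- 1 - p` to its right.
      obtain ⟨p, hp⟩ := Nat.exists_eq_add_of_le hm.1
      obtain ⟨L, hLn, hL⟩ := ih p (by omega) l (hf.mono le_rfl (by omega))
      obtain ⟨R, hRn, hR⟩ := ih (n - 1 - p) (by omega) (l + p + 1)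
        (hf.mono (by omega) (by omega))
      refine ⟨.node () L R, by simp only [BinaryTree.numNodes]; omega, fun i j h1 h2 h3 => ?_⟩
      simp only [treeColoring, hLn]
      split_ifs with h h'
      · exact hL i j h1 h2 h
      · exact hR i j (by omega) h2 (by omega)
      · rw [← hp]
        exact hf.eq_of_mem h1 (by omega) (by omega) h3

lemma treeColoring_injective (T T' : BinaryTree Unit) (l : ℕ) (hn : T.numNodes = T'.numNodes)
    (h : ∀ i j, l ≤ i → i < j → j ≤ l + T.numNodes →
      treeColoring T l i j = treeColoring T' l i j) : T = T' := by
  induction T generalizing l T' with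
  | nil =>
    cases T' with
    | nil => rfl
    | node _ L' R' => simp [BinaryTree.numNodes] at hn
  | node x L R hL hR =>
    cases T' with
    | nil => simp [BinaryTree.numNodes] at hn
    | node x' L' R' =>
      simp only [BinaryTree.numNodes] at hn h
      -- The color of the full interval reveals the position of the root.
      have hroot : L.numNodes = L'.numNodes := by
        have := h l (l + (L.numNodes + R.numNodes + 1)) le_rfl (by omega) le_rfl
        simp only [treeColoring] at this
        split_ifs at this <;> omega
      have h1 : L = L' := hL L' l hroot fun i j hi hij hj => by
        have := h i j hi hij (by omega)
        simp only [treeColoring] at this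
        rwa [if_pos (by omega), if_pos (by omega)] at this
      have h2 : R = R' := hR R' (l + L.numNodes + 1) (by omega) fun i j hi hij hj => by
        have := h i j (by omega) hij (by omega)
        simp only [treeColoring] at this
        rwa [if_neg (by omega), if_pos (by omega), if_neg (by omega), if_pos (by omega),
          ← hroot] at this
      rw [h1, h2]

/-! ### The positive roots of `A_n` -/

/-- The `i`-th standard basis vector of `ℝ^{n+1}`. -/
noncomputable def vertex (n i : ℕ) : EuclideanSpace ℝ (Fin (n + 1)) :=
  WithLp.toLp 2 fun k => if (k : ℕ) = i then 1 else 0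

/-- The root `e_i - e_j`. -/
noncomputable def root (n i j : ℕ) : EuclideanSpace ℝ (Fin (n + 1)) :=
  vertex n i - vertex n j

lemma single_eq_vertex (n : ℕ) (i : Fin (n + 1)) :
    EuclideanSpace.single i (1 : ℝ) = vertex n i := by
  ext k
  simp [vertex, Fin.ext_iff]

lemma root_add_root (n i j k : ℕ) : root n i j + root n j k = root n i k := by
  simp [root]

/-- The sum of the coordinates up to the `m`-th. -/
noncomputable def partialSum (n m : ℕ) : EuclideanSpace ℝ (Fin (n + 1)) →ₗ[ℝ] ℝ where
  toFun x := ∑ k : Fin (n + 1), if (k : ℕ) ≤ m then x k else 0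
  map_add' x y := by
    rw [← Finset.sum_add_distrib]
    exact Finset.sum_congr rfl fun k _ => by split_ifs <;> simp
  map_smul' c x := by
    simp [Finset.mul_sum]

lemma partialSum_vertex {n i : ℕ} (m : ℕ) (hi : i ≤ n) :
    partialSum n m (vertex n i) = if i ≤ m then 1 else 0 := by
  change ∑ k : Fin (n + 1), (if (k : ℕ) ≤ m then (if (k : ℕ) = i then (1 : ℝ) else 0) else 0) = _
  rw [Finset.sum_eq_single ⟨i, by omega⟩]
  · simp
  · intro k _ hk
    rw [if_neg (fun h => hk (Fin.ext h)), ite_self]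
  · simp

/-- Partial sums read off the coefficients in the simple roots, turning a positive root into the
indicator of `[i, j)`. Identities between roots thus become statements about intervals. -/
lemma partialSum_root {n i j : ℕ} (m : ℕ) (hij : i < j) (hj : j ≤ n) :
    partialSum n m (root n i j) = if i ≤ m ∧ m < j then 1 else 0 := by
  rw [root, map_sub, partialSum_vertex m (by omega), partialSum_vertex m hj]
  split_ifs <;> first | omega | norm_num

lemma root_inj {n i j i' j' : ℕ} (hij : i < j) (hj : j ≤ n) (hij' : i' < j') (hj' : j' ≤ n)
    (h : root n i j = root n i' j') : i = i' ∧ j = j' := by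
  have key (m : ℕ) : (i ≤ m ∧ m < j) ↔ (i' ≤ m ∧ m < j') := by
    have := congrArg (partialSum n m) h
    rw [partialSum_root m hij hj, partialSum_root m hij' hj'] at this
    split_ifs at this <;> first | tauto | simp at this
  have h1 := key i
  have h2 := key i'
  have h3 := key (j - 1)
  have h4 := key (j' - 1)
  omega

lemma mem_baseA {n : ℕ} {α : EuclideanSpace ℝ (Fin (n + 1))} :
    α ∈ baseA n ↔ ∃ i < n, α = root n i (i + 1) := by
  constructor
  · rintro ⟨i, rfl⟩
    exact ⟨i, i.2, by simp [single_eq_vertex, root]⟩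
  · rintro ⟨i, hi, rfl⟩
    exact ⟨⟨i, hi⟩, by simp [single_eq_vertex, root]⟩

lemma root_mem_closure_baseA {n i j : ℕ} (hij : i < j) (hj : j ≤ n) :
    root n i j ∈ AddSubmonoid.closure (baseA n) := by
  induction j, hij using Nat.le_induction with
  | base => exact AddSubmonoid.subset_closure (mem_baseA.2 ⟨i, by omega, rfl⟩)
  | succ j hij ih =>
    rw [← root_add_root n i j (j + 1)]
    exact add_mem (ih (by omega))
      (AddSubmonoid.subset_closure (mem_baseA.2 ⟨j, by omega, rfl⟩))

lemma partialSum_nonneg {n : ℕ} (m : ℕ) {α : EuclideanSpace ℝ (Fin (n + 1))}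
    (h : α ∈ AddSubmonoid.closure (baseA n)) : 0 ≤ partialSum n m α := by
  induction h using AddSubmonoid.closure_induction with
  | mem x hx =>
    obtain ⟨i, hi, rfl⟩ := mem_baseA.1 hx
    rw [partialSum_root m (by omega) (by omega)]
    split_ifs <;> norm_num
  | zero => simp
  | add x y _ _ hx hy => rw [map_add]; exact add_nonneg hx hy

lemma mem_positiveRootsA {n : ℕ} {α : EuclideanSpace ℝ (Fin (n + 1))} :
    α ∈ positiveRootsA n ↔ ∃ i j, i < j ∧ j ≤ n ∧ α = root n i j := by
  constructor
  · rintro ⟨⟨i, j, hij, rfl⟩, h⟩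
    -- If `j < i`, the partial sum up to `j` would be `-1`.
    have h0 := partialSum_nonneg j h
    rw [single_eq_vertex, single_eq_vertex, map_sub, partialSum_vertex _ (by omega),
      partialSum_vertex _ (by omega), if_pos le_rfl] at h0
    have hij' : (i : ℕ) ≠ j := fun h => hij (Fin.ext h)
    refine ⟨i, j, ?_, by omega, by simp [single_eq_vertex, root]⟩
    by_contra hlt
    rw [if_neg (by omega)] at h0
    norm_num at h0
  · rintro ⟨i, j, hij, hj, rfl⟩
    refine ⟨⟨⟨i, by omega⟩, ⟨j, by omega⟩, ?_, by simp [single_eq_vertex, root]⟩,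
      root_mem_closure_baseA hij hj⟩
    simp only [ne_eq, Fin.mk.injEq]
    omega

lemma rank_positiveRootsA (n : ℕ) : rank (positiveRootsA n) = n := by
  have hspan : Submodule.span ℝ (positiveRootsA n) =
      Submodule.span ℝ (Set.range fun i : Fin n => root n i (i + 1)) := by
    have hb : (Set.range fun i : Fin n => root n i (i + 1)) = baseA n := by
      ext α
      rw [mem_baseA]
      exact ⟨fun ⟨i, hi⟩ => ⟨i, i.2, hi.symm⟩, fun ⟨i, hi, h⟩ => ⟨⟨i, hi⟩, h.symm⟩⟩
    rw [hb]
    apply le_antisymm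
    · refine Submodule.span_le.2 fun α hα => ?_
      exact AddSubmonoid.closure_le (S := (Submodule.span ℝ (baseA n)).toAddSubmonoid).2
        Submodule.subset_span hα.2
    · refine Submodule.span_mono fun α hα => ?_
      obtain ⟨i, hi, rfl⟩ := mem_baseA.1 hα
      exact mem_positiveRootsA.2 ⟨i, i + 1, by omega, by omega, rfl⟩
  rw [rank, hspan, finrank_span_eq_card, Fintype.card_fin]
  refine LinearIndependent.of_pairwise_dual_eq_zero_one _ (fun i : Fin n => partialSum n i)
    (fun i j hij => ?_) (fun i => ?_)
  · have hij' : (i : ℕ) ≠ j := fun h => hij (Fin.ext h)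
    dsimp only
    rw [partialSum_root _ (by omega) (by omega), if_neg (by omega)]
  · rw [partialSum_root _ (by omega) (by omega), if_pos (by omega)]

/-! ### Fine decompositions and interval colorings -/

/-- The positive roots `e_i - e_j` for which `(i, j)` has color `m`. -/
def colorClass (n : ℕ) (f : ℕ → ℕ → ℕ) (m : ℕ) : Set (EuclideanSpace ℝ (Fin (n + 1))) :=
  {α | ∃ i j, i < j ∧ j ≤ n ∧ f i j = m ∧ α = root n i j}

/-- The decomposition of the positive roots of `A_n` into color classes. -/
def colorDecomposition (n : ℕ) (f : ℕ → ℕ → ℕ) : Set (Set (EuclideanSpace ℝ (Fin (n + 1)))) :=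
  colorClass n f '' Set.Iio n

lemma root_mem_colorClass {n i j m : ℕ} {f : ℕ → ℕ → ℕ} (hij : i < j) (hj : j ≤ n) :
    root n i j ∈ colorClass n f m ↔ f i j = m := by
  constructor
  · rintro ⟨i', j', hij', hj', hm, h⟩
    obtain ⟨rfl, rfl⟩ := root_inj hij hj hij' hj' h
    exact hm
  · exact fun h => ⟨i, j, hij, hj, h, rfl⟩

lemma isInversionSet_colorClass {n : ℕ} {f : ℕ → ℕ → ℕ} (hf : IsIntervalColoring 0 n f) (m : ℕ) :
    IsInversionSet (positiveRootsA n) (colorClass n f m) := by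
  have add_eq {i j i' j' p q : ℕ} (hij : i < j) (hj : j ≤ n) (hij' : i' < j') (hj' : j' ≤ n)
      (hpq : p < q) (hq : q ≤ n) (h : root n i j + root n i' j' = root n p q) :
      (p = i ∧ j = i' ∧ j' = q) ∨ (p = i' ∧ j' = i ∧ j = q) := by
    -- Comparing coefficients, `[p, q)` is the disjoint union of `[i, j)` and `[i', j')`, so these
    -- are adjacent.
    have key (m : ℕ) : ((i ≤ m ∧ m < j ∨ i' ≤ m ∧ m < j') ↔ p ≤ m ∧ m < q) ∧
        ¬ ((i ≤ m ∧ m < j) ∧ i' ≤ m ∧ m < j') := by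
      have := congrArg (partialSum n m) h
      rw [map_add, partialSum_root m hij hj, partialSum_root m hij' hj',
        partialSum_root m hpq hq] at this
      split_ifs at this <;> first | tauto | norm_num at this
    have hip := (key i).1.1 (Or.inl ⟨le_rfl, hij⟩)
    have hip' := (key i').1.1 (Or.inr ⟨le_rfl, hij'⟩)
    have hjq := (key (j - 1)).1.1 (Or.inl (by omega))
    have hjq' := (key (j' - 1)).1.1 (Or.inr (by omega))
    have hi := (key i).2
    have hi' := (key i').2
    have hq := (key (q - 1)).1.2 (by omega)
    have hj1 := (key j).1.2
    have hj1' := (key j').1.2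
    rcases (key p).1.2 ⟨le_rfl, hpq⟩ with hp | hp
    · clear hj1' key h
      omega
    · clear hj1 key h
      omega
  refine ⟨?_, ?_, ?_⟩
  · rintro α ⟨i, j, hij, hj, -, rfl⟩
    exact mem_positiveRootsA.2 ⟨i, j, hij, hj, rfl⟩
  · rintro α ⟨i, j, hij, hj, hm, rfl⟩ β ⟨i', j', hij', hj', hm', rfl⟩ hP
    obtain ⟨p, q, hpq, hq, h⟩ := mem_positiveRootsA.1 hP
    rw [h, root_mem_colorClass hpq hq]
    rcases add_eq hij hj hij' hj' hpq hq h with ⟨rfl, rfl, rfl⟩ | ⟨rfl, rfl, rfl⟩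
    · rcases hf.split p j j' (by omega) hij hij' hq with h | h <;> omega
    · rcases hf.split p j' j (by omega) hij' hij hq with h | h <;> omega
  · rintro α ⟨hα, hαm⟩ β ⟨hβ, hβm⟩ hP
    obtain ⟨i, j, hij, hj, rfl⟩ := mem_positiveRootsA.1 hα
    obtain ⟨i', j', hij', hj', rfl⟩ := mem_positiveRootsA.1 hβ
    refine ⟨hP, ?_⟩
    obtain ⟨p, q, hpq, hq, h⟩ := mem_positiveRootsA.1 hP
    rw [root_mem_colorClass hij hj] at hαm
    rw [root_mem_colorClass hij' hj'] at hβm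
    rw [h, root_mem_colorClass hpq hq]
    rcases add_eq hij hj hij' hj' hpq hq h with ⟨rfl, rfl, rfl⟩ | ⟨rfl, rfl, rfl⟩
    · rcases hf.split p j j' (by omega) hij hij' hq with h | h <;> omega
    · rcases hf.split p j' j (by omega) hij' hij hq with h | h <;> omega

lemma encard_Iio (n : ℕ) : (Set.Iio n).encard = n := by
  rw [← Finset.coe_Iio, Set.encard_coe_eq_coe_finsetCard, Nat.card_Iio]

lemma isFineDecomposition_colorDecomposition {n : ℕ} {f : ℕ → ℕ → ℕ}
    (hf : IsIntervalColoring 0 n f) :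
    IsFineDecomposition (positiveRootsA n) (colorDecomposition n f) := by
  have simple_mem {m m' : ℕ} (hm : m < n) (h : root n m (m + 1) ∈ colorClass n f m') :
      m = m' := by
    rw [root_mem_colorClass (by omega) (by omega), hf.simple m (by omega) hm] at h
    exact h
  have self_mem {m : ℕ} (hm : m < n) : root n m (m + 1) ∈ colorClass n f m := by
    rw [root_mem_colorClass (by omega) (by omega), hf.simple m (by omega) hm]
  refine ⟨⟨?_, ?_, ?_, ?_⟩, ?_⟩
  · rintro _ ⟨m, hm, rfl⟩
    exact isInversionSet_colorClass hf m
  · rintro _ ⟨m, hm, rfl⟩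
    exact ⟨_, self_mem hm⟩
  · rintro _ ⟨m, hm, rfl⟩ _ ⟨m', hm', rfl⟩ hne
    rw [Set.disjoint_left]
    rintro α ⟨i, j, hij, hj, hc, rfl⟩ h
    rw [root_mem_colorClass hij hj] at h
    exact hne (by rw [← hc, h])
  · ext α
    rw [mem_positiveRootsA]
    constructor
    · rintro ⟨_, ⟨m, hm, rfl⟩, i, j, hij, hj, -, rfl⟩
      exact ⟨i, j, hij, hj, rfl⟩
    · rintro ⟨i, j, hij, hj, rfl⟩
      have := hf.mem_Ico (Nat.zero_le i) hij hj
      exact ⟨_, ⟨f i j, by simp only [Set.mem_Iio]; omega, rfl⟩,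
        (root_mem_colorClass hij hj).2 rfl⟩
  · rw [rank_positiveRootsA, colorDecomposition, Set.InjOn.encard_image, encard_Iio]
    · intro m hm m' hm' h
      exact simple_mem hm (h ▸ self_mem hm)

/-- Although the decomposition is unlabelled, the color of a class is recovered from the simple root
it contains. -/
lemma colorDecomposition_injective {n : ℕ} {f g : ℕ → ℕ → ℕ} (hf : IsIntervalColoring 0 n f)
    (hg : IsIntervalColoring 0 n g) (h : colorDecomposition n f = colorDecomposition n g)
    {i j : ℕ} (hij : i < j) (hj : j ≤ n) : f i j = g i j := by
  have hm := hf.mem_Ico (Nat.zero_le i) hij hj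
  have hmn : f i j < n := by omega
  obtain ⟨m, -, hc⟩ : colorClass n f (f i j) ∈ colorDecomposition n g := h ▸ ⟨f i j, hmn, rfl⟩
  have h1 : root n (f i j) (f i j + 1) ∈ colorClass n g m := by
    rw [hc, root_mem_colorClass (by omega) (by omega), hf.simple _ (by omega) hmn]
  rw [root_mem_colorClass (by omega) (by omega), hg.simple _ (by omega) hmn] at h1
  have h2 : root n i j ∈ colorClass n g m := by
    rw [hc, root_mem_colorClass hij hj]
  rw [root_mem_colorClass hij hj] at h2
  omega

lemma IsInversionSet.root_split {n : ℕ} {A : Set (EuclideanSpace ℝ (Fin (n + 1)))}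
    (hA : IsInversionSet (positiveRootsA n) A) {i j k : ℕ} (hij : i < j) (hjk : j < k)
    (hk : k ≤ n) (h : root n i k ∈ A) : root n i j ∈ A ∨ root n j k ∈ A := by
  by_contra! hcon
  have := hA.coclosed (root n i j) ⟨mem_positiveRootsA.2 ⟨i, j, hij, by omega, rfl⟩, hcon.1⟩
    (root n j k) ⟨mem_positiveRootsA.2 ⟨j, k, hjk, hk, rfl⟩, hcon.2⟩
  rw [root_add_root] at this
  exact (this (mem_positiveRootsA.2 ⟨i, k, by omega, hk, rfl⟩)).2 h

lemma IsInversionSet.exists_simple {n : ℕ} {A : Set (EuclideanSpace ℝ (Fin (n + 1)))}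
    (hA : IsInversionSet (positiveRootsA n) A) (hne : A.Nonempty) :
    ∃ m < n, root n m (m + 1) ∈ A := by
  obtain ⟨α, hα⟩ := hne
  obtain ⟨i, j, hij, hj, rfl⟩ := mem_positiveRootsA.1 (hA.subset hα)
  induction j, hij using Nat.le_induction with
  | base => exact ⟨i, by omega, hα⟩
  | succ j hij ih =>
    rcases hA.root_split (by omega) (Nat.lt_succ_self j) hj hα with h | h
    · exact ih (by omega) h
    · exact ⟨j, by omega, h⟩

lemma exists_colorDecomposition_eq {n : ℕ} {D : Set (Set (EuclideanSpace ℝ (Fin (n + 1))))}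
    (hD : IsFineDecomposition (positiveRootsA n) D) :
    ∃ f, IsIntervalColoring 0 n f ∧ colorDecomposition n f = D := by
  obtain ⟨hD, hcard⟩ := hD
  rw [rank_positiveRootsA] at hcard
  have unique {A B : Set (EuclideanSpace ℝ (Fin (n + 1)))} (hA : A ∈ D) (hB : B ∈ D)
      {α : EuclideanSpace ℝ (Fin (n + 1))} (h : α ∈ A) (h' : α ∈ B) : A = B := by
    by_contra hne
    exact Set.disjoint_left.1 (hD.disjoint A hA B hB hne) h h'
  have hs : ∀ A, ∃ m, A ∈ D → m < n ∧ root n m (m + 1) ∈ A := fun A => by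
    by_cases hA : A ∈ D
    · obtain ⟨m, hm, h⟩ := (hD.inversion A hA).exists_simple (hD.nonempty A hA)
      exact ⟨m, fun _ => ⟨hm, h⟩⟩
    · exact ⟨0, fun h => absurd h hA⟩
  choose s hs using hs
  have hinj : Set.InjOn s D := fun A hA B hB h =>
    unique hA hB (hs A hA).2 (h ▸ (hs B hB).2)
  -- The choice of a simple root is injective by disjointness, hence surjective because there are as
  -- many parts as simple roots.
  have himage : s '' D = Set.Iio n := by
    refine (Set.finite_Iio n).eq_of_subset_of_encard_le' ?_ ?_
    · rintro _ ⟨A, hA, rfl⟩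
      exact (hs A hA).1
    · rw [hinj.encard_image, hcard, encard_Iio]
  have hP : ∀ i j, ∃ A, i < j → j ≤ n → A ∈ D ∧ root n i j ∈ A := fun i j => by
    by_cases h : i < j ∧ j ≤ n
    · have hr : root n i j ∈ ⋃₀ D := hD.union ▸ mem_positiveRootsA.2 ⟨i, j, h.1, h.2, rfl⟩
      obtain ⟨A, hA, hr⟩ := hr
      exact ⟨A, fun _ _ => ⟨hA, hr⟩⟩
    · exact ⟨∅, fun h1 h2 => absurd ⟨h1, h2⟩ h⟩
  choose part hpart using hP
  have part_eq {A : Set (EuclideanSpace ℝ (Fin (n + 1)))} (hA : A ∈ D) {i j : ℕ} (hij : i < j)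
      (hj : j ≤ n) (h : root n i j ∈ A) : part i j = A :=
    unique (hpart i j hij hj).1 hA (hpart i j hij hj).2 h
  have hclass : ∀ A ∈ D, colorClass n (fun i j => s (part i j)) (s A) = A := fun A hA => by
    ext α
    constructor
    · rintro ⟨i, j, hij, hj, h, rfl⟩
      rw [← hinj (hpart i j hij hj).1 hA h]
      exact (hpart i j hij hj).2
    · intro h
      obtain ⟨i, j, hij, hj, rfl⟩ := mem_positiveRootsA.1 ((hD.inversion A hA).subset h)
      exact ⟨i, j, hij, hj, congrArg s (part_eq hA hij hj h), rfl⟩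
  refine ⟨fun i j => s (part i j), ⟨fun i _ hi => ?_, fun i j k _ hij hjk hk => ?_⟩, ?_⟩
  · obtain ⟨A, hA, rfl⟩ : i ∈ s '' D := himage ▸ hi
    rw [part_eq hA (by omega) (by omega) (hs A hA).2]
  · have h := hpart i k (by omega) hk
    rcases (hD.inversion _ h.1).root_split hij hjk hk h.2 with h' | h'
    · exact Or.inl (by rw [part_eq h.1 hij (by omega) h'])
    · exact Or.inr (by rw [part_eq h.1 hjk hk h'])
  · rw [colorDecomposition, ← himage, Set.image_image]
    exact (Set.image_congr hclass).trans (Set.image_id' D)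

lemma a_eq_catalan (n : ℕ) : a n = catalan n := by
  have coloring {T : BinaryTree Unit} (hT : T.numNodes = n) :
      IsIntervalColoring 0 n (treeColoring T 0) := by
    simpa [hT] using isIntervalColoring_treeColoring T 0
  have himage : {D | IsFineDecomposition (positiveRootsA n) D} =
      (fun T => colorDecomposition n (treeColoring T 0)) ''
        (BinaryTree.treesOfNumNodesEq n : Set (BinaryTree Unit)) := by
    ext D
    constructor
    · intro hD
      obtain ⟨f, hf, rfl⟩ := exists_colorDecomposition_eq hD
      obtain ⟨T, hT, h⟩ := exists_treeColoring_eq n 0 f (by simpa using hf)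
      refine ⟨T, by simpa [BinaryTree.mem_treesOfNumNodesEq] using hT, ?_⟩
      refine Set.image_congr fun m _ => Set.ext fun α => ?_
      constructor
      · rintro ⟨i, j, hij, hj, hm, rfl⟩
        exact ⟨i, j, hij, hj, by rw [h i j (by omega) hij (by omega), hm], rfl⟩
      · rintro ⟨i, j, hij, hj, hm, rfl⟩
        exact ⟨i, j, hij, hj, by rw [← h i j (by omega) hij (by omega), hm], rfl⟩
    · rintro ⟨T, hT, rfl⟩
      exact isFineDecomposition_colorDecomposition
        (coloring (by simpa [BinaryTree.mem_treesOfNumNodesEq] using hT))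
  rw [a, fineCount, himage, Set.InjOn.ncard_image, Set.ncard_coe_finset,
    BinaryTree.treesOfNumNodesEq_card_eq_catalan]
  intro T hT T' hT' h
  rw [Finset.mem_coe, BinaryTree.mem_treesOfNumNodesEq] at hT hT'
  exact treeColoring_injective T T' 0 (hT.trans hT'.symm) fun i j _ hij hj =>
    colorDecomposition_injective (coloring hT) (coloring hT') h hij (by omega)

/-! ### Primitive inversion sets of `A_2` -/

lemma mem_positiveRootsA_two {α : EuclideanSpace ℝ (Fin (2 + 1))} :
    α ∈ positiveRootsA 2 ↔ α = root 2 0 1 ∨ α = root 2 1 2 ∨ α = root 2 0 2 := by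
  rw [mem_positiveRootsA]
  constructor
  · rintro ⟨i, j, hij, hj, rfl⟩
    interval_cases j <;> interval_cases i <;> simp
  · rintro (h | h | h)
    exacts [⟨0, 1, by omega, by omega, h⟩, ⟨1, 2, by omega, by omega, h⟩,
      ⟨0, 2, by omega, by omega, h⟩]

/-- With both or neither simple root, `Φ` is everything or empty. If only `α` is in `Φ`, then either
`Φ = {α, α + β}`, an inflation from `{β}` since both roots agree modulo `β`, or `Φ = {α}`, an
inflation from `{α}` with empty `Ψ`. -/
lemma not_isPrimitive_of_isInversionSet {Φ : Set (EuclideanSpace ℝ (Fin (2 + 1)))}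
    (hΦ : IsInversionSet (positiveRootsA 2) Φ) :
    ¬ IsPrimitive (positiveRootsA 2) (baseA 2) Φ := by
  intro hprim
  have single_ne (α β : EuclideanSpace ℝ (Fin (2 + 1))) (hα : α ∈ baseA 2) (hβ : β ∈ baseA 2)
      (hne : α ≠ β) (Ψ : Set _) (X : Set _) :
      ¬ IsInflation (positiveRootsA 2) {α} Φ Ψ X := by
    intro h
    rcases hprim.inflation {α} (Set.singleton_subset_iff.2 hα) Ψ X h with h | h
    · exact Set.singleton_ne_empty α h
    · rw [← h] at hβ
      exact hne hβ.symm
  have sum_mem (α β : EuclideanSpace ℝ (Fin (2 + 1))) (hα : α ∈ baseA 2) (hβ : β ∈ baseA 2)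
      (hP : ∀ γ, γ ∈ positiveRootsA 2 ↔ γ = α ∨ γ = β ∨ γ = α + β)
      (hlin : ∀ c : ℝ, α ≠ c • β) (hα' : α ∈ Φ) (hβ' : β ∉ Φ) : α + β ∉ Φ := by
    intro hs
    refine single_ne β α hβ hα (fun h => hlin 1 (by rw [one_smul, h]))
      {(Submodule.span ℝ {β}).mkQ α} ∅ ⟨?_, Set.empty_subset _, ?_⟩
    · rw [Set.singleton_subset_iff]
      refine ⟨⟨α, (hP α).2 (Or.inl rfl), rfl⟩, ?_⟩
      simp only [Set.mem_singleton_iff, Submodule.mkQ_apply, Submodule.Quotient.mk_eq_zero,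
        Submodule.mem_span_singleton, not_exists]
      exact fun c hc => hlin c hc.symm
    · ext γ
      simp only [Set.union_empty, Set.mem_ofPred_eq, Set.mem_singleton_iff, Submodule.mkQ_apply,
        Submodule.Quotient.eq, Submodule.mem_span_singleton]
      constructor
      · intro hγ
        refine ⟨hΦ.subset hγ, ?_⟩
        rcases (hP γ).1 (hΦ.subset hγ) with rfl | rfl | rfl
        · exact ⟨0, by simp⟩
        · exact absurd hγ hβ'
        · exact ⟨1, by simp⟩
      · rintro ⟨hγ, c, hc⟩
        rcases (hP γ).1 hγ with rfl | rfl | rfl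
        · exact hα'
        -- Here `c • β = β - α`, which would give `α = (1 - c) • β`.
        · exact absurd (by rw [sub_smul, one_smul, hc]; abel) (hlin (1 - c))
        · exact hs
  have sum_not_mem (α β : EuclideanSpace ℝ (Fin (2 + 1))) (hα : α ∈ baseA 2) (hβ : β ∈ baseA 2)
      (hP : ∀ γ, γ ∈ positiveRootsA 2 ↔ γ = α ∨ γ = β ∨ γ = α + β)
      (hne : α ≠ β) (hα' : α ∈ Φ) (hβ' : β ∉ Φ) : α + β ∈ Φ := by
    by_contra hs
    refine single_ne α β hα hβ hne ∅ {α} ⟨Set.empty_subset _, ?_, ?_⟩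
    · rw [Set.singleton_subset_iff]
      exact ⟨hΦ.subset hα', Submodule.subset_span rfl⟩
    · ext γ
      simp only [Set.mem_empty_iff_false, and_false, Set.ofPred_false, Set.empty_union,
        Set.mem_singleton_iff]
      constructor
      · intro hγ
        rcases (hP γ).1 (hΦ.subset hγ) with rfl | rfl | rfl
        · rfl
        · exact absurd hγ hβ'
        · exact absurd hγ hs
      · rintro rfl
        exact hα'
  have ha : root 2 0 1 ∈ baseA 2 := mem_baseA.2 ⟨0, by omega, rfl⟩
  have hb : root 2 1 2 ∈ baseA 2 := mem_baseA.2 ⟨1, by omega, rfl⟩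
  have hab : root 2 0 1 + root 2 1 2 = root 2 0 2 := root_add_root 2 0 1 2
  have hlin (c : ℝ) : root 2 0 1 ≠ c • root 2 1 2 := fun h => by
    have := congrArg (partialSum 2 0) h
    rw [map_smul, partialSum_root _ (by omega) (by omega),
      partialSum_root _ (by omega) (by omega)] at this
    simp at this
  have hlin' (c : ℝ) : root 2 1 2 ≠ c • root 2 0 1 := fun h => by
    have := congrArg (partialSum 2 1) h
    rw [map_smul, partialSum_root _ (by omega) (by omega),
      partialSum_root _ (by omega) (by omega)] at this
    simp at this
  have hP (γ : EuclideanSpace ℝ (Fin (2 + 1))) : γ ∈ positiveRootsA 2 ↔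
      γ = root 2 0 1 ∨ γ = root 2 1 2 ∨ γ = root 2 0 1 + root 2 1 2 := by
    rw [mem_positiveRootsA_two, hab]
  have hP' (γ : EuclideanSpace ℝ (Fin (2 + 1))) : γ ∈ positiveRootsA 2 ↔
      γ = root 2 1 2 ∨ γ = root 2 0 1 ∨ γ = root 2 1 2 + root 2 0 1 := by
    rw [hP, add_comm (root 2 1 2)]
    tauto
  by_cases h1 : root 2 0 1 ∈ Φ <;> by_cases h2 : root 2 1 2 ∈ Φ
  · refine hprim.ne_all (hΦ.subset.antisymm fun γ hγ => ?_)
    rcases (hP γ).1 hγ with rfl | rfl | rfl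
    exacts [h1, h2, hΦ.closed _ h1 _ h2 hγ]
  · exact sum_mem _ _ ha hb hP hlin h1 h2
      (sum_not_mem _ _ ha hb hP (fun h => hlin 1 (by rw [one_smul, h])) h1 h2)
  · exact sum_mem _ _ hb ha hP' hlin' h2 h1
      (sum_not_mem _ _ hb ha hP' (fun h => hlin' 1 (by rw [one_smul, h])) h2 h1)
  · refine hprim.ne_empty (Set.eq_empty_of_forall_notMem fun γ hγ => ?_)
    rcases (hP γ).1 (hΦ.subset hγ) with rfl | rfl | rfl
    · exact h1 hγ
    · exact h2 hγ
    · exact (hΦ.coclosed _ ⟨(hP _).2 (by simp), h1⟩ _ ⟨(hP _).2 (by simp), h2⟩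
        (hΦ.subset hγ)).2 hγ

end FineDecomposition

theorem mainTheorem7 :
    -- `A_2` has no primitive inversion sets
    (¬ ∃ Φ : Set (EuclideanSpace ℝ (Fin (2 + 1))),
      FineDecomposition.IsInversionSet (FineDecomposition.positiveRootsA 2) Φ ∧
      FineDecomposition.IsPrimitive (FineDecomposition.positiveRootsA 2)
        (FineDecomposition.baseA 2) Φ) ∧
    -- the recurrence and its initial value
    FineDecomposition.a 0 = 1 ∧
    (∀ n : ℕ, 1 ≤ n → FineDecomposition.a n =
      ∑ i ∈ Finset.Icc 1 n, FineDecomposition.a (i - 1) * FineDecomposition.a (n - i)) ∧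
    -- the Catalan numbers
    (∀ n : ℕ, FineDecomposition.a n = catalan n ∧
      (FineDecomposition.a n : ℚ) = ((2 * n).choose n : ℚ) / ((n : ℚ) + 1)) := by
  refine ⟨fun ⟨Φ, h1, h2⟩ => FineDecomposition.not_isPrimitive_of_isInversionSet h1 h2, ?_, ?_, ?_⟩
  · rw [FineDecomposition.a_eq_catalan, catalan_zero]
  · intro n hn
    obtain ⟨n, rfl⟩ := Nat.exists_eq_add_of_le' hn
    simp only [FineDecomposition.a_eq_catalan]
    rw [catalan_succ, Fin.sum_univ_eq_sum_range (fun i => catalan i * catalan (n - i)) n.succ]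
    refine Finset.sum_nbij' (fun i => i + 1) (fun i => i - 1) ?_ ?_ ?_ ?_ ?_
    all_goals simp only [Finset.mem_range, Finset.mem_Icc]
    any_goals intros; omega
    intro i _
    rw [Nat.add_sub_cancel, Nat.add_sub_add_right]
  · intro n
    refine ⟨FineDecomposition.a_eq_catalan n, ?_⟩
    rw [FineDecomposition.a_eq_catalan, eq_div_iff (by positivity)]
    have := succ_mul_catalan_eq_centralBinom n
    rw [Nat.centralBinom] at this
    rw [← this]
    push_cast
    ring
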